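/- Let $T>0$, let $p,q\in(1,\infty)$ be conjugate exponents, and define on $L^p(0,T)$ the total variation functional \[ \mathcal R_{TV}(u)=\sup\Big\{-\int_0^T\varphi' u\,dt \;:\; \varphi\in C_c^\infty(0,T),\ \|\varphi\|_{L^\infty(0,T)}\le 1\Big\}\in[0,+\infty]. \] For $\xi\in L^q(0,T)$ and $v\in L^p(0,T)$ write $\langle\xi,v\rangle=\int_0^T\xi v\,dt$, and let $\partial\mathcal R_{TV}(u)\subset L^q(0,T)$ be the set of all $\xi\in L^q(0,T)$ with $\mathcal R_{TV}(v)\ge\mathcal R_{TV}(u)+\langle\xi,v-u\rangle$ for all $v\in L^p(0,T)$. Let $u\in BV(0,T)\subset L^p(0,T)$, that is, $u\in L^p(0,T)$ and $\mathcal R_{TV}(u)<\infty$. Then the distributional derivative $Du$ is a finite signed measure on $(0,T)$; let $Du=(Du)^+-(Du)^-$ be its Jordan decomposition. For every $\xi\in L^q(0,T)$ one has $\xi\in\partial\mathcal R_{TV}(u)$ if and only if $\xi=-\varphi'$ for some $\varphi\in W^{1,q}(0,T)$ (identified with its continuous representative on $[0,T]$) such that $\varphi(0)=\varphi(T)=0$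 and \[ \|\varphi\|_{L^\infty(0,T)}\le 1,\qquad \operatorname{supp}(Du)^+\subseteq\{\varphi=1\},\qquad \operatorname{supp}(Du)^-\subseteq\{\varphi=-1\}, \] where the supports are taken in $(0,T)$. Moreover, $\mathcal R_{TV}(u)=\langle\xi,u\rangle$ for every $\xi\in\partial\mathcal R_{TV}(u)$. -/

import Mathlib

open MeasureTheory Set
open scoped ENNReal Distributions

noncomputable section

/-- The open time interval `(0, T)`. -/
def timeInterval (T : ℝ) : TopologicalSpace.Opens ℝ := ⟨Ioo 0 T, isOpen_Ioo⟩

/-- Lebesgue measure on `(0, T)`. -/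
abbrev timeMeasure (T : ℝ) : Measure ℝ := volume.restrict (Ioo 0 T)

/-- The space `L^r(0, T)` for a real exponent `r`. -/
abbrev LTime (T r : ℝ) : Type := Lp ℝ (ENNReal.ofReal r) (timeMeasure T)

/-- The duality pairing `⟨ξ, v⟩ = ∫₀ᵀ ξ v dt` between `L^q(0, T)` and `L^p(0, T)`. -/
def timePairing {T p q : ℝ} (ξ : LTime T q) (v : LTime T p) : ℝ :=
  ∫ t, ξ t * v t ∂timeMeasure T

/-- The total variation functional on `L^p(0, T)`, with values in `[0, +∞]`:
`R_TV(u) = sup { -∫₀ᵀ φ' u dt | φ ∈ C_c^∞(0, T), ‖φ‖_∞ ≤ 1 }`. -/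
def totalVar {T p : ℝ} (u : LTime T p) : EReal :=
  ⨆ (φ : 𝓓(timeInterval T, ℝ)) (_ : ∀ t, |φ t| ≤ 1),
    ((-∫ t, deriv φ t * u t ∂timeMeasure T : ℝ) : EReal)

/-- `BV(0, T)` as a subset of `L^p(0, T)`: the effective domain of the total variation. -/
def BVTime (T p : ℝ) : Set (LTime T p) := {u | totalVar u < ⊤}

/-- The subdifferential at `u` of a functional `R : L^p(0, T) → (-∞, +∞]`, as a subset of
`L^q(0, T)`: all `ξ` with `R(v) ≥ R(u) + ⟨ξ, v - u⟩` for every `v ∈ L^p(0, T)`. -/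
def subdiff {T p : ℝ} (q : ℝ) (R : LTime T p → EReal) (u : LTime T p) : Set (LTime T q) :=
  {ξ | ∀ v : LTime T p, R u + (timePairing ξ (v - u) : EReal) ≤ R v}

/-- The integral of `f` against a finite signed measure, through its Jordan decomposition. -/
def signedIntegral {α : Type*} [MeasurableSpace α] (μ : SignedMeasure α) (f : α → ℝ) : ℝ :=
  ∫ t, f t ∂μ.toJordanDecomposition.posPart - ∫ t, f t ∂μ.toJordanDecomposition.negPart

/-- The signed measure `μ` on `(0, T)` is the distributional derivative of `u`:
`∫₀ᵀ φ' u dt = -∫ φ dμ` for all `φ ∈ C_c^∞(0, T)`. -/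
def IsDistribDeriv {T p : ℝ} (u : LTime T p) (μ : SignedMeasure (Ioo 0 T)) : Prop :=
  ∀ φ : 𝓓(timeInterval T, ℝ),
    ∫ t, deriv φ t * u t ∂timeMeasure T = -signedIntegral μ (fun t => φ (t : ℝ))

open Classical in
/-- The distributional derivative `Du`, a finite signed measure on `(0, T)`
(with the value `0` if `u` has no such derivative). -/
def distribDeriv {T p : ℝ} (u : LTime T p) : SignedMeasure (Ioo 0 T) :=
  if h : ∃ μ, IsDistribDeriv u μ then h.choose else 0

/-- `φ` is the continuous representative on `[0, T]` of an element of the Sobolev space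
`W^{1,q}(0, T)`, and `g ∈ L^q(0, T)` is its weak derivative. -/
structure IsW1Time {T q : ℝ} (φ : ℝ → ℝ) (g : LTime T q) : Prop where
  continuousOn : ContinuousOn φ (Icc 0 T)
  memLp : MemLp φ (ENNReal.ofReal q) (timeMeasure T)
  weakDeriv : ∀ ψ : 𝓓(timeInterval T, ℝ),
    ∫ t, deriv ψ t * φ t ∂timeMeasure T = -∫ t, ψ t * g t ∂timeMeasure T

end

/-! `totalVar` is subadditive and vanishes at 0. Testing the subgradient inequality with `v = u + w`
and with `v = 0` therefore shows that a subgradient ξ at u satisfies ⟨ξ,w⟩ ≤ R(w) for all w and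
⟨ξ,u⟩ = R(u); conversely, these two properties give the subgradient inequality by subtraction.

Both are read off from φ(t) = -∫₀ᵗ ξ. Taking w = ±1_{(0,t]}, whose total variation is at most 1, and
0 when t = T, gives |φ| ≤ 1 and φ(T) = 0. Integration by parts turns ⟨ξ,u⟩ into ∫ φ dDu
(`IsDistribDeriv.integral_mul_eq`), and R(u) is the total mass |Du|(0,T) (`totalVar_eq`). So ⟨ξ,u⟩ =
R(u) is the equality case of |∫ φ dDu| ≤ |Du|(0,T), which for continuous φ means φ = ±1 on the
supports of the two Jordan parts.

The analytic input is the existence of Du: mollifications of u have variation bounded by R(u), hence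
so has u on a set of full measure; there it is a difference of monotone functions, which supply
Stieltjes measures. Every integration by parts is Fubini applied to a distribution function, and the
du Bois-Reymond lemma identifies u with the distribution function of Du up to a constant, invisible
to a ξ of mean zero. -/

open Filter Topology

/-! ### Primitives on (0, T) and integration by parts via Fubini. -/

/-- Fubini's theorem on the region `{(t, x) | τ x ≤ t}`. -/
theorem integral_mul_setIntegral_le_swap {X : Type*} [MeasurableSpace X] {μ : Measure ℝ}
    [SFinite μ] {ν : Measure X} [SFinite ν] {τ : X → ℝ} (hτ : Measurable τ) {g : ℝ → ℝ} {h : X → ℝ}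
    (hg : Integrable g μ) (hh : Integrable h ν) :
    ∫ t, g t * ∫ x in {x | τ x ≤ t}, h x ∂ν ∂μ = ∫ x, h x * ∫ t in Ici (τ x), g t ∂μ ∂ν := by
  have hS : MeasurableSet {z : ℝ × X | τ z.2 ≤ z.1} :=
    measurableSet_le (hτ.comp measurable_snd) measurable_fst
  have hint := (hg.mul_prod hh).indicator hS
  have hswap := integral_integral_swap (μ := μ) (ν := ν)
    (f := fun t x => {z : ℝ × X | τ z.2 ≤ z.1}.indicator (fun z => g z.1 * h z.2) (t, x)) hint
  have h1 : ∀ t, g t * ∫ x in {x | τ x ≤ t}, h x ∂ν =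
      ∫ x, {z : ℝ × X | τ z.2 ≤ z.1}.indicator (fun z => g z.1 * h z.2) (t, x) ∂ν := by
    intro t
    rw [← integral_indicator (measurableSet_le hτ measurable_const), ← integral_const_mul]
    refine integral_congr_ae (.of_forall fun x => ?_)
    by_cases hx : τ x ≤ t <;> simp [hx]
  have h2 : ∀ x, h x * ∫ t in Ici (τ x), g t ∂μ =
      ∫ t, {z : ℝ × X | τ z.2 ≤ z.1}.indicator (fun z => g z.1 * h z.2) (t, x) ∂μ := by
    intro x
    rw [← integral_indicator measurableSet_Ici, ← integral_const_mul]
    refine integral_congr_ae (.of_forall fun t => ?_)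
    by_cases hx : τ x ≤ t <;> simp [hx, mul_comm]
  simp_rw [h1, h2]
  exact hswap

/-- The primitive `t ↦ ∫₀ᵗ g` of a function on `(0, T)`. -/
noncomputable def timePrimitive (T : ℝ) (g : ℝ → ℝ) (t : ℝ) : ℝ := ∫ s in Iic t, g s ∂timeMeasure T

section Primitive

variable {T : ℝ} {g : ℝ → ℝ}

theorem timePrimitive_zero : timePrimitive T g 0 = 0 := by
  rw [timePrimitive, Measure.restrict_restrict measurableSet_Iic]
  have : Iic (0 : ℝ) ∩ Ioo 0 T = ∅ := by
    ext x; simp only [mem_inter_iff, mem_Iic, mem_Ioo, mem_empty_iff_false, iff_false]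
    intro h; linarith [h.1, h.2.1]
  simp [this]

theorem timePrimitive_eq_intervalIntegral (hg : Integrable g (timeMeasure T)) (t : ℝ) :
    timePrimitive T g t = ∫ s in (0 : ℝ)..t, g s ∂timeMeasure T := by
  rw [← intervalIntegral.integral_Iic_sub_Iic hg.integrableOn hg.integrableOn]
  exact (sub_eq_self.2 timePrimitive_zero).symm

theorem timePrimitive_end : timePrimitive T g T = ∫ t, g t ∂timeMeasure T := by
  rw [timePrimitive, Measure.restrict_restrict measurableSet_Iic]
  rw [inter_eq_right.2 fun x hx => hx.2.le]

theorem continuous_timePrimitive (hg : Integrable g (timeMeasure T)) :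
    Continuous (timePrimitive T g) := by
  rw [funext (timePrimitive_eq_intervalIntegral hg)]
  exact intervalIntegral.continuous_primitive (fun a b => hg.intervalIntegrable) 0

theorem setIntegral_Ici_timeMeasure (hg : Integrable g (timeMeasure T)) (s : ℝ) :
    ∫ t in Ici s, g t ∂timeMeasure T = (∫ t, g t ∂timeMeasure T) - timePrimitive T g s := by
  rw [integral_Ici_eq_integral_Ioi, timePrimitive, ← compl_Iic,
    setIntegral_compl measurableSet_Iic hg]

/-- Integration by parts against the distribution function of a measure. -/
theorem integral_mul_distribution_eq {X : Type*} [MeasurableSpace X] {ν : Measure X} [SFinite ν]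
    {τ : X → ℝ} (hτ : Measurable τ) {h : X → ℝ} (hg : Integrable g (timeMeasure T))
    (hg0 : ∫ t, g t ∂timeMeasure T = 0) (hh : Integrable h ν) :
    ∫ t, g t * ∫ x in {x | τ x ≤ t}, h x ∂ν ∂timeMeasure T =
      -∫ x, h x * timePrimitive T g (τ x) ∂ν := by
  -- As g has mean zero, its integral over the tail from s is minus its primitive at s: no boundary
  -- term remains.
  rw [integral_mul_setIntegral_le_swap hτ hg hh]
  simp_rw [setIntegral_Ici_timeMeasure hg, hg0, zero_sub, mul_neg, integral_neg]

end Primitive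

/-! ### Test functions and the du Bois-Reymond lemma. -/

section TestFunctions

variable {T : ℝ}

theorem testFunction_support_subset (ψ : 𝓓(timeInterval T, ℝ)) : tsupport ψ ⊆ Ioo 0 T :=
  ψ.tsupport_subset

theorem testFunction_deriv_continuous (ψ : 𝓓(timeInterval T, ℝ)) : Continuous (deriv ψ) :=
  ψ.contDiff.continuous_deriv (by simp)

theorem testFunction_deriv_bounded (ψ : 𝓓(timeInterval T, ℝ)) : ∃ C, ∀ t, ‖deriv ψ t‖ ≤ C :=
  (testFunction_deriv_continuous ψ).bounded_above_of_compact_support ψ.hasCompactSupport.deriv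

theorem testFunction_bounded (ψ : 𝓓(timeInterval T, ℝ)) : ∃ C, ∀ t, ‖ψ t‖ ≤ C :=
  ψ.continuous.bounded_above_of_compact_support ψ.hasCompactSupport

theorem testFunction_deriv_integrable (ψ : 𝓓(timeInterval T, ℝ)) :
    Integrable (deriv ψ) (timeMeasure T) :=
  ((testFunction_deriv_continuous ψ).integrable_of_hasCompactSupport
    ψ.hasCompactSupport.deriv).restrict

theorem testFunction_deriv_mul_integrable (ψ : 𝓓(timeInterval T, ℝ)) {f : ℝ → ℝ}
    (hf : Integrable f (timeMeasure T)) :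
    Integrable (fun t => deriv ψ t * f t) (timeMeasure T) := by
  obtain ⟨C, hC⟩ := testFunction_deriv_bounded ψ
  exact hf.bdd_mul (testFunction_deriv_continuous ψ).aestronglyMeasurable (.of_forall hC)

theorem integral_timeMeasure_eq_integral {g : ℝ → ℝ} (hg : tsupport g ⊆ Ioo 0 T) (f : ℝ → ℝ) :
    ∫ t, g t * f t ∂timeMeasure T = ∫ t, g t * f t := by
  refine setIntegral_eq_integral_of_forall_compl_eq_zero fun x hx => ?_
  rw [image_eq_zero_of_notMem_tsupport fun h => hx (hg h), zero_mul]

theorem timePrimitive_deriv_testFunction (ψ : 𝓓(timeInterval T, ℝ)) (t : ℝ) :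
    timePrimitive T (deriv ψ) t = ψ t := by
  rw [← ψ.hasCompactSupport.integral_Iic_deriv_eq (ψ.contDiff.of_le (by simp)) t, timePrimitive,
    Measure.restrict_restrict measurableSet_Iic, inter_comm,
    ← Measure.restrict_restrict measurableSet_Ioo]
  refine setIntegral_eq_integral_of_forall_compl_eq_zero fun x hx => ?_
  exact image_eq_zero_of_notMem_tsupport fun h =>
    hx (testFunction_support_subset ψ (tsupport_deriv_subset h))

theorem integral_deriv_testFunction (ψ : 𝓓(timeInterval T, ℝ)) :
    ∫ t, deriv ψ t ∂timeMeasure T = 0 := by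
  rw [← timePrimitive_end, timePrimitive_deriv_testFunction]
  exact image_eq_zero_of_notMem_tsupport fun h => lt_irrefl _ (testFunction_support_subset ψ h).2

/-- A compact subset of `(0, T)` lies in a slightly smaller interval. -/
theorem IsCompact.exists_subset_Ioo {K : Set ℝ} (hK : IsCompact K) (hKT : K ⊆ Ioo 0 T)
    (hT : 0 < T) : ∃ a b, 0 < a ∧ a < b ∧ b < T ∧ K ⊆ Ioo a b := by
  rcases K.eq_empty_or_nonempty with rfl | hne
  · exact ⟨T / 3, T / 2, by linarith, by linarith, by linarith, empty_subset _⟩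
  · obtain ⟨x, hx, hxK⟩ := hK.exists_isLeast hne
    obtain ⟨y, hy, hyK⟩ := hK.exists_isGreatest hne
    have h1 := hKT hx
    have h2 := hKT hy
    have h3 := hyK hx
    refine ⟨x / 2, (y + T) / 2, by linarith [h1.1], by linarith [h1.1, h2.2], by linarith [h2.2],
      fun z hz => ⟨?_, ?_⟩⟩
    · linarith [hxK hz, h1.1]
    · linarith [hyK hz, h2.2]

/-- A smooth function supported in a compact subinterval is a test function. -/
theorem exists_testFunction {f : ℝ → ℝ} (hf : ContDiff ℝ (⊤ : ℕ∞) f) {a b : ℝ} (ha : 0 < a)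
    (hb : b < T) (h0 : ∀ x ∉ Icc a b, f x = 0) : ∃ ψ : 𝓓(timeInterval T, ℝ), ⇑ψ = f := by
  have hsub : tsupport f ⊆ Icc a b :=
    closure_minimal (fun x hx => by_contra fun h => hx (h0 x h)) isClosed_Icc
  exact ⟨⟨f, hf, .of_isClosed_subset isCompact_Icc (isClosed_tsupport f) hsub,
    hsub.trans fun x hx => ⟨ha.trans_le hx.1, hx.2.trans_lt hb⟩⟩, rfl⟩

/-- Smooth functions with compact support in `(0, T)` and mean zero are derivatives of
test functions. -/
theorem exists_testFunction_deriv_eq (hT : 0 < T) {θ : ℝ → ℝ} (hθ : ContDiff ℝ (⊤ : ℕ∞) θ)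
    (hc : HasCompactSupport θ) (hs : tsupport θ ⊆ Ioo 0 T) (h0 : ∫ t, θ t = 0) :
    ∃ ψ : 𝓓(timeInterval T, ℝ), deriv ψ = θ := by
  obtain ⟨a, b, ha, hab, hb, hK⟩ := IsCompact.exists_subset_Ioo hc hs hT
  have hz : ∀ x ∉ Ioo a b, θ x = 0 := fun x hx => image_eq_zero_of_notMem_tsupport fun h => hx (hK h)
  have hd : ∀ x, HasDerivAt (fun t => ∫ s in a..t, θ s) (θ x) x := fun x =>
    hθ.continuous.integral_hasStrictDerivAt a x |>.hasDerivAt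
  have hder : deriv (fun t => ∫ s in a..t, θ s) = θ := funext fun x => (hd x).deriv
  have hsm : ContDiff ℝ (⊤ : ℕ∞) (fun t => ∫ s in a..t, θ s) := by
    rw [contDiff_infty_iff_deriv, hder]
    exact ⟨fun x => (hd x).differentiableAt, hθ⟩
  -- Left of a the primitive has seen nothing of θ; right of b it has seen all of it, and the mean
  -- of θ is zero.
  obtain ⟨ψ, hψ⟩ := exists_testFunction hsm ha hb (fun x hx => by
    rcases lt_or_ge x a with hxa | hxa
    · refine intervalIntegral.integral_zero_ae (.of_forall fun s hs => hz s fun h => ?_)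
      rw [uIoc_of_ge hxa.le] at hs
      exact absurd hs.2 (not_le.2 h.1)
    · have hxb : b < x := not_le.1 fun h => hx ⟨hxa, h⟩
      rw [intervalIntegral.integral_eq_integral_of_support_subset, h0]
      intro y hy
      have := not_imp_comm.1 (hz y) hy
      exact ⟨this.1, (this.2.trans hxb).le⟩)
  exact ⟨ψ, by rw [hψ, hder]⟩

/-- The du Bois-Reymond lemma: a function whose weak derivative vanishes is constant. -/
theorem ae_eq_const_of_integral_deriv_mul_eq_zero (hT : 0 < T) {f : ℝ → ℝ}
    (hf : Integrable f (timeMeasure T))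
    (h : ∀ ψ : 𝓓(timeInterval T, ℝ), ∫ t, deriv ψ t * f t ∂timeMeasure T = 0) :
    ∃ c : ℝ, f =ᵐ[timeMeasure T] fun _ => c := by
  let B : ContDiffBump (T / 2) := ⟨T / 8, T / 4, by linarith, by linarith⟩
  let η : ℝ → ℝ := B.normed volume
  have hηs : ContDiff ℝ (⊤ : ℕ∞) η := B.contDiff_normed
  have hηt : tsupport η ⊆ Ioo 0 T := by
    rw [B.tsupport_normed_eq, Real.closedBall_eq_Icc]
    intro x hx
    have h1 : B.rOut = T / 4 := rfl
    rw [h1] at hx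
    exact ⟨by linarith [hx.1], by linarith [hx.2]⟩
  have hηc : HasCompactSupport η := B.hasCompactSupport_normed
  have hη1 : ∫ t, η t = 1 := B.integral_normed
  set c : ℝ := ∫ t, η t * f t ∂timeMeasure T with hc
  refine ⟨c, ?_⟩
  have hfc : Integrable (fun t => f t - c) (timeMeasure T) := hf.sub (integrable_const c)
  have key := isOpen_Ioo.ae_eq_zero_of_integral_contDiff_smul_eq_zero (μ := volume)
    (U := Ioo 0 T) (f := fun t => f t - c) (IntegrableOn.locallyIntegrableOn hfc) (by
      intro g hg hgc hgs
      have hgi : Integrable g := hg.continuous.integrable_of_hasCompactSupport hgc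
      have hηi : Integrable η := hηs.continuous.integrable_of_hasCompactSupport hηc
      -- Subtracting the multiple of η with the same integral makes g a derivative of a test
      -- function; the correction produces exactly the constant c.
      obtain ⟨ψ, hψ⟩ := exists_testFunction_deriv_eq hT (θ := fun t => g t - (∫ s, g s) • η t)
        (hg.sub (hηs.const_smul _)) (hgc.sub (hηc.smul_left (f := fun _ => ∫ s, g s)))
        ((tsupport_sub g _).trans (union_subset hgs
          ((tsupport_smul_subset_right _ _).trans hηt)))
        (by
          have h1 := integral_sub hgi (hηi.smul (∫ s, g s))
          simp only [Pi.smul_apply] at h1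
          rw [h1, integral_smul, hη1]; simp)
      have h0 := h ψ
      rw [hψ] at h0
      obtain ⟨Cg, hCg⟩ := hg.continuous.bounded_above_of_compact_support hgc
      obtain ⟨Ch, hCh⟩ := hηs.continuous.bounded_above_of_compact_support hηc
      have i1 : Integrable (fun t => g t * f t) (timeMeasure T) :=
        hf.bdd_mul hg.continuous.aestronglyMeasurable (.of_forall hCg)
      have i2 : Integrable (fun t => η t * f t) (timeMeasure T) :=
        hf.bdd_mul hηs.continuous.aestronglyMeasurable (.of_forall hCh)
      have e1 : ∫ t, (g t - (∫ s, g s) • η t) * f t ∂timeMeasure T =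
          (∫ t, g t * f t ∂timeMeasure T) - (∫ s, g s) * c := by
        rw [hc, ← integral_const_mul, ← integral_sub i1 (i2.const_mul _)]
        refine integral_congr_ae (.of_forall fun t => ?_)
        simp only [smul_eq_mul]; ring
      have e2 : ∫ t, g t ∂timeMeasure T = ∫ s, g s := by
        simpa using integral_timeMeasure_eq_integral hgs (fun _ => 1)
      simp_rw [smul_eq_mul]
      rw [← integral_timeMeasure_eq_integral hgs]
      simp_rw [mul_sub]
      rw [integral_sub i1 (hgi.restrict.mul_const c), integral_mul_const, e2, ← e1, h0])
  rw [EventuallyEq, ae_restrict_iff' measurableSet_Ioo]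
  filter_upwards [key] with t ht hmem
  exact sub_eq_zero.1 (ht hmem)

end TestFunctions

/-! ### Signed integrals through arbitrary decompositions. -/

section SignedIntegral

variable {X : Type*} [MeasurableSpace X]

/-- Two decompositions P - N = μ - ν agree after moving terms, P + ν = μ + N, an identity of
positive measures that can be integrated. Thus Du may be built from a decomposition that is not the
Jordan one. -/
theorem signedIntegral_toSignedMeasure_sub (μ ν : Measure X) [IsFiniteMeasure μ]
    [IsFiniteMeasure ν] {f : X → ℝ} (hf : Measurable f) {C : ℝ} (hC : ∀ x, ‖f x‖ ≤ C) :
    signedIntegral (μ.toSignedMeasure - ν.toSignedMeasure) f = ∫ x, f x ∂μ - ∫ x, f x ∂ν := by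
  set J := (μ.toSignedMeasure - ν.toSignedMeasure).toJordanDecomposition with hJ
  have h1 : J.posPart.toSignedMeasure - J.negPart.toSignedMeasure =
      μ.toSignedMeasure - ν.toSignedMeasure :=
    SignedMeasure.toSignedMeasure_toJordanDecomposition _
  have h2 : J.posPart + ν = μ + J.negPart := by
    rw [← Measure.toSignedMeasure_eq_toSignedMeasure_iff, Measure.toSignedMeasure_add,
      Measure.toSignedMeasure_add]
    rw [sub_eq_sub_iff_add_eq_add] at h1
    exact h1
  have hi : ∀ (m : Measure X) [IsFiniteMeasure m], Integrable f m := fun m _ =>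
    .of_bound hf.aestronglyMeasurable C (.of_forall hC)
  have h3 : ∫ x, f x ∂(J.posPart + ν) = ∫ x, f x ∂(μ + J.negPart) := by rw [h2]
  rw [integral_add_measure (hi _) (hi _), integral_add_measure (hi _) (hi _)] at h3
  rw [signedIntegral, ← hJ]
  linarith

end SignedIntegral

/-! ### Smooth steps. -/

/-- The primitive of a normed bump function, a smooth step from `0` to `1`. -/
noncomputable def smoothStep (B : ContDiffBump (0 : ℝ)) (y : ℝ) : ℝ :=
  ∫ t in (-B.rOut)..y, B.normed volume t

section SmoothStep

variable (B : ContDiffBump (0 : ℝ))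

theorem hasDerivAt_smoothStep (y : ℝ) : HasDerivAt (smoothStep B) (B.normed volume y) y :=
  (B.continuous_normed.integral_hasStrictDerivAt (-B.rOut) y).hasDerivAt

theorem contDiff_smoothStep : ContDiff ℝ (⊤ : ℕ∞) (smoothStep B) := by
  rw [contDiff_infty_iff_deriv, funext fun y => (hasDerivAt_smoothStep B y).deriv]
  exact ⟨fun y => (hasDerivAt_smoothStep B y).differentiableAt, B.contDiff_normed⟩

theorem monotone_smoothStep : Monotone (smoothStep B) :=
  monotone_of_hasDerivAt_nonneg (hasDerivAt_smoothStep B) fun y => B.nonneg_normed y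

theorem smoothStep_eq_zero {y : ℝ} (hy : y ≤ -B.rOut) : smoothStep B y = 0 := by
  refine intervalIntegral.integral_zero_ae (.of_forall fun s hs => ?_)
  rw [uIoc_of_ge hy] at hs
  refine Function.notMem_support.1 fun h => ?_
  rw [B.support_normed_eq, Real.ball_eq_Ioo] at h
  linarith [h.1, hs.2]

theorem smoothStep_eq_one {y : ℝ} (hy : B.rOut ≤ y) : smoothStep B y = 1 := by
  rw [smoothStep, intervalIntegral.integral_eq_integral_of_support_subset, B.integral_normed]
  rw [B.support_normed_eq, Real.ball_eq_Ioo]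
  exact fun x hx => ⟨by linarith [hx.1], by linarith [hx.2]⟩

theorem smoothStep_nonneg (y : ℝ) : 0 ≤ smoothStep B y := by
  rw [← smoothStep_eq_zero B (min_le_right y (-B.rOut))]
  exact monotone_smoothStep B (min_le_left _ _)

theorem smoothStep_le_one (y : ℝ) : smoothStep B y ≤ 1 := by
  rw [← smoothStep_eq_one B (le_max_right y B.rOut)]
  exact monotone_smoothStep B (le_max_left _ _)

end SmoothStep

/-! ### From finite total variation to a difference of Stieltjes functions. -/

section Mollification

variable {T C : ℝ} {u : ℝ → ℝ}

/-- Mollifications of a function of finite total variation have uniformly bounded variation. -/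
theorem sum_abs_mollification_sub_le (hu : Integrable u (timeMeasure T))
    (hC : ∀ ψ : 𝓓(timeInterval T, ℝ), (∀ t, |ψ t| ≤ 1) →
      -∫ t, deriv ψ t * u t ∂timeMeasure T ≤ C)
    (B : ContDiffBump (0 : ℝ)) {s : ℕ → ℝ} (hs : Monotone s) (N : ℕ) (h0 : B.rOut < s 0)
    (hN : s N + B.rOut < T) :
    ∑ i ∈ Finset.range N, |(∫ t, B.normed volume (t - s (i + 1)) * u t ∂timeMeasure T) -
      ∫ t, B.normed volume (t - s i) * u t ∂timeMeasure T| ≤ C := by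
  set ρ : ℝ → ℝ := B.normed volume with hρ
  set v : ℝ → ℝ := fun x => ∫ t, ρ (t - x) * u t ∂timeMeasure T with hv
  change ∑ i ∈ Finset.range N, |v (s (i + 1)) - v (s i)| ≤ C
  -- These signs turn the increments of v into absolute values once the test function Σ εᵢ kᵢ is
  -- paired with u.
  set ε : ℕ → ℝ := fun i => SignType.sign (v (s (i + 1)) - v (s i)) with hε
  have hε1 : ∀ i, |ε i| ≤ 1 := by
    intro i
    simp only [hε]
    rcases SignType.sign (v (s (i + 1)) - v (s i)) with _ | _ | _ <;> simp
  -- A smoothed indicator of [sᵢ, sᵢ₊₁]. The kᵢ are nonnegative and telescope to at most 1, whence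
  -- |ψ| ≤ 1.
  set k : ℕ → ℝ → ℝ := fun i t => smoothStep B (t - s i) - smoothStep B (t - s (i + 1)) with hk
  have hk0 : ∀ i t, 0 ≤ k i t := fun i t =>
    sub_nonneg.2 (monotone_smoothStep B (sub_le_sub_left (hs i.le_succ) t))
  have hksum : ∀ t, ∑ i ∈ Finset.range N, k i t =
      smoothStep B (t - s 0) - smoothStep B (t - s N) := fun t =>
    Finset.sum_range_sub' (fun i => smoothStep B (t - s i)) N
  have hstep : ∀ x, ContDiff ℝ (⊤ : ℕ∞) fun t => smoothStep B (t - x) := fun x =>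
    (contDiff_smoothStep B).comp (contDiff_id.sub contDiff_const)
  have hsm : ContDiff ℝ (⊤ : ℕ∞) fun t => ∑ i ∈ Finset.range N, ε i * k i t :=
    ContDiff.sum fun i _ => contDiff_const.mul ((hstep _).sub (hstep _))
  obtain ⟨ψ, hψ⟩ := exists_testFunction (T := T) hsm (sub_pos.2 h0) hN (fun t ht => by
    refine Finset.sum_eq_zero fun i hi => ?_
    have hiN : s (i + 1) ≤ s N := hs (Finset.mem_range.1 hi)
    have hi0 : s 0 ≤ s i := hs i.zero_le
    have hii : s i ≤ s (i + 1) := hs i.le_succ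
    simp only [hk]
    rcases lt_or_ge t (s 0 - B.rOut) with h | h
    · rw [smoothStep_eq_zero B (by linarith), smoothStep_eq_zero B (by linarith), sub_self,
        mul_zero]
    · have h' : s N + B.rOut < t := not_le.1 fun h' => ht ⟨h, h'⟩
      rw [smoothStep_eq_one B (by linarith), smoothStep_eq_one B (by linarith), sub_self,
        mul_zero])
  have hψ1 : ∀ t, |ψ t| ≤ 1 := by
    intro t
    rw [hψ]
    calc |∑ i ∈ Finset.range N, ε i * k i t| ≤ ∑ i ∈ Finset.range N, |ε i * k i t| :=
          Finset.abs_sum_le_sum_abs _ _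
      _ ≤ ∑ i ∈ Finset.range N, k i t := Finset.sum_le_sum fun i _ => by
          rw [abs_mul, abs_of_nonneg (hk0 i t)]
          exact mul_le_of_le_one_left (hk0 i t) (hε1 i)
      _ = smoothStep B (t - s 0) - smoothStep B (t - s N) := hksum t
      _ ≤ 1 := by linarith [smoothStep_le_one B (t - s 0), smoothStep_nonneg B (t - s N)]
  have hder : deriv ψ = fun t => ∑ i ∈ Finset.range N, ε i * (ρ (t - s i) - ρ (t - s (i + 1))) := by
    rw [hψ]
    funext t
    refine HasDerivAt.deriv (HasDerivAt.fun_sum fun i _ => ?_)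
    have hd : ∀ x, HasDerivAt (fun t => smoothStep B (t - x)) (ρ (t - x)) t := fun x =>
      (hasDerivAt_smoothStep B (t - x)).comp_sub_const t x
    exact ((hd _).sub (hd _)).const_mul (ε i)
  have hint : ∀ x, Integrable (fun t => ρ (t - x) * u t) (timeMeasure T) := by
    intro x
    have hcont : Continuous ρ := B.continuous_normed
    obtain ⟨M, hM⟩ := hcont.bounded_above_of_compact_support B.hasCompactSupport_normed
    exact hu.bdd_mul (hcont.comp (continuous_id.sub continuous_const)).aestronglyMeasurable
      (.of_forall fun t => hM _)
  refine le_trans (le_of_eq ?_) (hC ψ hψ1)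
  have e1 : ∀ i, ε i * (v (s (i + 1)) - v (s i)) = |v (s (i + 1)) - v (s i)| := fun i =>
    sign_mul_self _
  rw [hder, ← integral_neg]
  have e2 : ∀ t, -((∑ i ∈ Finset.range N, ε i * (ρ (t - s i) - ρ (t - s (i + 1)))) * u t) =
      ∑ i ∈ Finset.range N, ε i * (ρ (t - s (i + 1)) * u t - ρ (t - s i) * u t) := by
    intro t
    rw [Finset.sum_mul, ← Finset.sum_neg_distrib]
    exact Finset.sum_congr rfl fun i _ => by ring
  simp_rw [e2]
  rw [integral_finsetSum (Finset.range N) (f := fun i t => ε i * (ρ (t - s (i + 1)) * u t -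
    ρ (t - s i) * u t)) fun i _ => ((hint (s (i + 1))).sub (hint (s i))).const_mul (ε i)]
  refine Finset.sum_congr rfl fun i _ => ?_
  rw [integral_const_mul, integral_sub (hint _) (hint _)]
  exact (e1 i).symm

/-- A function of finite total variation has bounded variation on a set of full measure. -/
theorem exists_eVariationOn_le (hu : Integrable u (timeMeasure T))
    (hC : ∀ ψ : 𝓓(timeInterval T, ℝ), (∀ t, |ψ t| ≤ 1) →
      -∫ t, deriv ψ t * u t ∂timeMeasure T ≤ C) :
    ∃ G : Set ℝ, G ⊆ Ioo 0 T ∧ (∀ᵐ t ∂timeMeasure T, t ∈ G) ∧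
      eVariationOn u G ≤ ENNReal.ofReal C := by
  -- The outer radius is always twice the inner one: almost everywhere convergence of the
  -- mollifications needs a bounded ratio.
  let B : ℕ → ContDiffBump (0 : ℝ) := fun n =>
    ⟨1 / (n + 1 : ℝ), 2 * (1 / (n + 1 : ℝ)), by positivity,
      lt_mul_of_one_lt_left (by positivity) one_lt_two⟩
  have hB : Tendsto (fun n => (B n).rOut) atTop (𝓝 0) := by
    have h := (tendsto_one_div_add_atTop_nhds_zero_nat (𝕜 := ℝ)).const_mul 2
    rwa [mul_zero] at h
  set w : ℝ → ℝ := (Ioo 0 T).indicator u with hw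
  have hwi : Integrable w := (integrable_indicator_iff measurableSet_Ioo).2 hu
  have hconv := ContDiffBump.ae_convolution_tendsto_right_of_locallyIntegrable (μ := volume)
    (φ := B) (K := 2) hB (.of_forall fun n => le_rfl) hwi.locallyIntegrable
  have hvw : ∀ n x, convolution ((B n).normed volume) w
      (ContinuousLinearMap.lsmul ℝ ℝ) volume x =
      ∫ t, (B n).normed volume (t - x) * u t ∂timeMeasure T := by
    intro n x
    rw [convolution_eq_swap, ← integral_indicator measurableSet_Ioo]
    refine integral_congr_ae (.of_forall fun t => ?_)
    simp only [ContinuousLinearMap.lsmul_apply, smul_eq_mul, hw]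
    rw [← (B n).normed_neg (x - t), neg_sub]
    by_cases ht : t ∈ Ioo 0 T <;> simp [ht]
  simp_rw [hvw] at hconv
  refine ⟨{x | x ∈ Ioo 0 T ∧ Tendsto (fun n => ∫ t, (B n).normed volume (t - x) * u t
    ∂timeMeasure T) atTop (𝓝 (u x))}, fun x hx => hx.1, ?_, ?_⟩
  · rw [ae_restrict_iff' measurableSet_Ioo]
    filter_upwards [hconv] with x hx hmem
    rw [hw, indicator_of_mem hmem] at hx
    exact ⟨hmem, hx⟩
  -- A finite partition in G keeps a positive distance from 0 and T, so the mollified bound applies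
  -- for large n; it passes to the limit because the mollifications converge at each partition
  -- point.
  · refine iSup_le fun ⟨N, s, hs, hsG⟩ => ?_
    have hlim : Tendsto (fun n => ∑ i ∈ Finset.range N,
        |(∫ t, (B n).normed volume (t - s (i + 1)) * u t ∂timeMeasure T) -
          ∫ t, (B n).normed volume (t - s i) * u t ∂timeMeasure T|) atTop
        (𝓝 (∑ i ∈ Finset.range N, |u (s (i + 1)) - u (s i)|)) :=
      tendsto_finsetSum _ fun i _ => ((hsG (i + 1)).2.sub (hsG i).2).abs
    have hle : ∑ i ∈ Finset.range N, |u (s (i + 1)) - u (s i)| ≤ C := by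
      refine le_of_tendsto hlim ?_
      have h1 := (hsG 0).1.1
      have h2 := (hsG N).1.2
      filter_upwards [hB.eventually_lt_const h1, hB.eventually_lt_const (sub_pos.2 h2)]
        with n hn1 hn2
      exact sum_abs_mollification_sub_le hu hC (B n) hs N hn1 (by linarith)
    simp_rw [edist_dist, Real.dist_eq]
    rw [← ENNReal.ofReal_sum_of_nonneg fun i _ => abs_nonneg _]
    exact ENNReal.ofReal_le_ofReal hle

/-- A monotone bounded function on a set agrees, up to a countable set, with a Stieltjes
function. -/
theorem exists_stieltjesFunction_of_monotoneOn {f : ℝ → ℝ} {G : Set ℝ} (hf : MonotoneOn f G)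
    (hb : BddBelow (f '' G)) (ha : BddAbove (f '' G)) :
    ∃ F : StieltjesFunction ℝ, ∀ᵐ x, x ∈ G → f x = F x := by
  -- The monotone extension to the line equals its right limit off its countable set of
  -- discontinuities.
  obtain ⟨g, hg, hfg⟩ := hf.exists_monotone_extension hb ha
  refine ⟨hg.stieltjesFunction, ?_⟩
  filter_upwards [hg.countable_not_continuousAt.ae_notMem volume] with x hx hxG
  rw [hfg hxG, Monotone.stieltjesFunction_eq]
  exact (not_not.1 hx : ContinuousAt g x).continuousWithinAt.rightLim_eq.symm

/-- A function of finite total variation is a difference of two Stieltjes functions. -/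
theorem exists_ae_eq_stieltjes_sub (hu : Integrable u (timeMeasure T))
    (hC : ∀ ψ : 𝓓(timeInterval T, ℝ), (∀ t, |ψ t| ≤ 1) →
      -∫ t, deriv ψ t * u t ∂timeMeasure T ≤ C) :
    ∃ F₁ F₂ : StieltjesFunction ℝ, u =ᵐ[timeMeasure T] fun t => F₁ t - F₂ t := by
  obtain ⟨G, hGT, hG, hvar⟩ := exists_eVariationOn_le hu hC
  have hfin : eVariationOn u G ≠ ∞ := (hvar.trans_lt ENNReal.ofReal_lt_top).ne
  have hbv : BoundedVariationOn u G := hfin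
  obtain ⟨p, q, hp, hq, hpq, hsum⟩ :=
    hbv.locallyBoundedVariationOn.exists_monotoneOn_sub_monotoneOn'
  set V := (eVariationOn u G).toReal with hV
  have hle : ∀ x ∈ G, ∀ y ∈ G, x ≤ y → (p y - p x) + (q y - q x) ≤ V := by
    intro x hx y hy hxy
    rw [hsum x hx y hy, variationOnFromTo.eq_of_le _ _ hxy]
    exact ENNReal.toReal_mono hfin (eVariationOn.mono _ inter_subset_left)
  -- The increments of the two monotone parts are nonnegative and sum to at most V, so each part
  -- stays within V of its value at a base point. This boundedness permits monotone extension to the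
  -- line.
  have hbdd : ∀ f g : ℝ → ℝ, MonotoneOn f G → MonotoneOn g G →
      (∀ x ∈ G, ∀ y ∈ G, x ≤ y → (f y - f x) + (g y - g x) ≤ V) →
      BddBelow (f '' G) ∧ BddAbove (f '' G) := by
    intro f g hf hg h
    rcases G.eq_empty_or_nonempty with rfl | ⟨c, hc⟩
    · simp
    have key : ∀ x ∈ G, |f x - f c| ≤ V := by
      intro x hx
      rcases le_total x c with hxc | hxc
      · rw [abs_of_nonpos (sub_nonpos.2 (hf hx hc hxc))]
        linarith [h x hx c hc hxc, hg hx hc hxc]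
      · rw [abs_of_nonneg (sub_nonneg.2 (hf hc hx hxc))]
        linarith [h c hc x hx hxc, hg hc hx hxc]
    constructor
    · refine ⟨f c - V, ?_⟩
      rintro _ ⟨x, hx, rfl⟩
      linarith [(abs_le.1 (key x hx)).1]
    · refine ⟨f c + V, ?_⟩
      rintro _ ⟨x, hx, rfl⟩
      linarith [(abs_le.1 (key x hx)).2]
  obtain ⟨hp1, hp2⟩ := hbdd p q hp hq hle
  obtain ⟨hq1, hq2⟩ := hbdd q p hq hp fun x hx y hy hxy => by linarith [hle x hx y hy hxy]
  obtain ⟨F₁, h1⟩ := exists_stieltjesFunction_of_monotoneOn hp hp1 hp2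
  obtain ⟨F₂, h2⟩ := exists_stieltjesFunction_of_monotoneOn hq hq1 hq2
  refine ⟨F₁, F₂, ?_⟩
  filter_upwards [hG, ae_restrict_of_ae h1, ae_restrict_of_ae h2] with x hx hx1 hx2
  rw [← hx1 hx, ← hx2 hx, hpq, Pi.sub_apply]

/-- The measure on `(0, T)` induced by a Stieltjes function. -/
noncomputable def stieltjesTimeMeasure (T : ℝ) (F : StieltjesFunction ℝ) : Measure (Ioo 0 T) :=
  F.measure.comap (↑)

instance (F : StieltjesFunction ℝ) : IsFiniteMeasure (stieltjesTimeMeasure T F) := by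
  refine ⟨?_⟩
  rw [stieltjesTimeMeasure, comap_subtype_coe_apply measurableSet_Ioo]
  exact (measure_mono ((image_subset_range _ _).trans (by
    rw [Subtype.range_coe]; exact Ioo_subset_Icc_self))).trans_lt
      (isCompact_Icc (a := 0) (b := T)).measure_lt_top

theorem stieltjesTimeMeasure_real_le (F : StieltjesFunction ℝ) {t : ℝ} (ht : t ∈ Ioo 0 T) :
    (stieltjesTimeMeasure T F).real {s | (s : ℝ) ≤ t} = F t - F 0 := by
  have h : ((↑) : Ioo 0 T → ℝ) '' {s | (s : ℝ) ≤ t} = Ioc 0 t := by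
    ext x
    constructor
    · rintro ⟨s, hs, rfl⟩
      exact ⟨s.2.1, hs⟩
    · exact fun hx => ⟨⟨x, hx.1, hx.2.trans_lt ht.2⟩, hx.2, rfl⟩
  rw [measureReal_def, stieltjesTimeMeasure, comap_subtype_coe_apply measurableSet_Ioo, h,
    StieltjesFunction.measure_Ioc, ENNReal.toReal_ofReal (sub_nonneg.2 (F.mono ht.1.le))]

/-- Integration by parts for the distribution function of a finite measure on `(0, T)`. -/
theorem integral_mul_measureReal_le {g : ℝ → ℝ} (hg : Integrable g (timeMeasure T))
    (hg0 : ∫ t, g t ∂timeMeasure T = 0) (ν : Measure (Ioo 0 T)) [IsFiniteMeasure ν] :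
    ∫ t, g t * ν.real {s | (s : ℝ) ≤ t} ∂timeMeasure T =
      -∫ s, timePrimitive T g s ∂ν := by
  have h := integral_mul_distribution_eq (ν := ν) (τ := ((↑) : Ioo 0 T → ℝ))
    measurable_subtype_coe hg hg0 (integrable_const (1 : ℝ))
  simpa using h

theorem stieltjesFunction_integrable (F : StieltjesFunction ℝ) :
    Integrable F (timeMeasure T) :=
  ((F.mono.monotoneOn _).integrableOn_isCompact (μ := volume) (isCompact_Icc (a := 0) (b := T)))
    |>.mono_set Ioo_subset_Icc_self

/-- On (0, T) the distribution function of the induced measure is F - F 0, and the constant F 0 is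
lost against a derivative of mean zero. -/
theorem integral_deriv_mul_stieltjes (F : StieltjesFunction ℝ) (ψ : 𝓓(timeInterval T, ℝ)) :
    ∫ t, deriv ψ t * F t ∂timeMeasure T = -∫ s, ψ (s : ℝ) ∂stieltjesTimeMeasure T F := by
  have h := integral_mul_measureReal_le (testFunction_deriv_integrable ψ)
    (integral_deriv_testFunction ψ) (stieltjesTimeMeasure T F)
  simp_rw [timePrimitive_deriv_testFunction] at h
  rw [← h]
  have h1 : ∫ t, deriv ψ t * (stieltjesTimeMeasure T F).real {s | (s : ℝ) ≤ t} ∂timeMeasure T =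
      ∫ t, (deriv ψ t * F t - deriv ψ t * F 0) ∂timeMeasure T := by
    refine setIntegral_congr_fun measurableSet_Ioo fun t ht => ?_
    simp only [stieltjesTimeMeasure_real_le F ht, mul_sub]
  rw [h1, integral_sub (testFunction_deriv_mul_integrable ψ (stieltjesFunction_integrable F))
    ((testFunction_deriv_integrable ψ).mul_const _), integral_mul_const,
    integral_deriv_testFunction, zero_mul, sub_zero]

theorem signedIntegral_stieltjes_sub (F₁ F₂ : StieltjesFunction ℝ) (ψ : 𝓓(timeInterval T, ℝ))
    (hu : u =ᵐ[timeMeasure T] fun t => F₁ t - F₂ t) :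
    ∫ t, deriv ψ t * u t ∂timeMeasure T =
      -signedIntegral ((stieltjesTimeMeasure T F₁).toSignedMeasure -
        (stieltjesTimeMeasure T F₂).toSignedMeasure) (fun t => ψ (t : ℝ)) := by
  obtain ⟨C, hC⟩ := testFunction_bounded ψ
  rw [signedIntegral_toSignedMeasure_sub _ _ (f := fun t : Ioo 0 T => ψ (t : ℝ))
    (ψ.continuous.measurable.comp measurable_subtype_coe) (fun x => hC x)]
  have h1 : ∫ t, deriv ψ t * u t ∂timeMeasure T =
      ∫ t, (deriv ψ t * F₁ t - deriv ψ t * F₂ t) ∂timeMeasure T := by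
    refine integral_congr_ae ?_
    filter_upwards [hu] with t ht
    rw [ht, mul_sub]
  rw [h1, integral_sub (testFunction_deriv_mul_integrable ψ (stieltjesFunction_integrable F₁))
    (testFunction_deriv_mul_integrable ψ (stieltjesFunction_integrable F₂)), integral_deriv_mul_stieltjes,
    integral_deriv_mul_stieltjes]
  ring

end Mollification

/-! ### Existence of the distributional derivative. -/

section BV

variable {T p : ℝ}

theorem lTime_integrable (hp : 1 ≤ p) (u : LTime T p) : Integrable u (timeMeasure T) :=
  (Lp.memLp u).integrable (by simpa using hp)

theorem le_totalVar (u : LTime T p) (ψ : 𝓓(timeInterval T, ℝ)) (hψ : ∀ t, |ψ t| ≤ 1) :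
    ((-∫ t, deriv ψ t * u t ∂timeMeasure T : ℝ) : EReal) ≤ totalVar u :=
  le_iSup₂_of_le ψ hψ le_rfl

theorem totalVar_nonneg (u : LTime T p) : 0 ≤ totalVar u := by
  have h := le_totalVar u 0 (by simp)
  have h0 : ⇑(0 : 𝓓(timeInterval T, ℝ)) = fun _ => 0 := rfl
  simpa [h0] using h

/-- A function of finite total variation has a finite signed measure as derivative. -/
theorem exists_isDistribDeriv (hp : 1 ≤ p) {u : LTime T p} (hu : u ∈ BVTime T p) :
    ∃ μ, IsDistribDeriv u μ := by
  obtain ⟨F₁, F₂, hF⟩ := exists_ae_eq_stieltjes_sub (lTime_integrable hp u)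
    (C := (totalVar u).toReal) fun ψ hψ => by
      rw [← EReal.coe_le_coe_iff, EReal.coe_toReal (ne_of_lt hu)
        (ne_of_gt (EReal.bot_lt_zero.trans_le (totalVar_nonneg u)))]
      exact le_totalVar u ψ hψ
  exact ⟨_, fun ψ => signedIntegral_stieltjes_sub F₁ F₂ ψ hF⟩

/-- Which measure is chosen does not matter: later arguments use only `IsDistribDeriv`. -/
theorem isDistribDeriv_distribDeriv (hp : 1 ≤ p) {u : LTime T p}
    (hu : u ∈ BVTime T p) : IsDistribDeriv u (distribDeriv u) := by
  have h := exists_isDistribDeriv hp hu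
  rw [distribDeriv, dif_pos h]
  exact h.choose_spec

end BV

/-! ### Integrals of functions bounded by 1 against a signed measure, and the equality case. -/

section Duality

variable {X : Type*} [MeasurableSpace X]

theorem abs_signedIntegral_le (μ : SignedMeasure X) {f : X → ℝ} (h1 : ∀ x, |f x| ≤ 1) :
    |signedIntegral μ f| ≤ μ.toJordanDecomposition.posPart.real univ +
      μ.toJordanDecomposition.negPart.real univ := by
  have h : ∀ (m : Measure X) [IsFiniteMeasure m], |∫ x, f x ∂m| ≤ m.real univ := fun m _ => by
    simpa using norm_integral_le_of_norm_le_const (μ := m) (f := f) (C := 1) (.of_forall h1)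
  exact (abs_sub _ _).trans (add_le_add (h _) (h _))

/-- Off K the integrand is at least -1, so it falls short of 1 by at most 2 there. -/
theorem measureReal_sub_le_integral (m : Measure X) [IsFiniteMeasure m] {f : X → ℝ}
    (hf : Measurable f) (h1 : ∀ x, |f x| ≤ 1) {K : Set X} (hK : MeasurableSet K)
    (hfK : ∀ x ∈ K, f x = 1) : m.real univ - 2 * m.real Kᶜ ≤ ∫ x, f x ∂m := by
  have hi : Integrable f m := .of_bound hf.aestronglyMeasurable 1 (.of_forall h1)
  have hind : Integrable (Kᶜ.indicator fun _ => (2 : ℝ)) m := (integrable_const 2).indicator hK.compl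
  have h : m.real univ - 2 * m.real Kᶜ = ∫ x, (1 - Kᶜ.indicator (fun _ => (2 : ℝ)) x) ∂m := by
    rw [integral_sub (integrable_const 1) hind, integral_indicator hK.compl]
    simp [mul_comm]
  rw [h]
  refine integral_mono ((integrable_const 1).sub hind) hi fun x => ?_
  by_cases hx : x ∈ K
  · simp [hx, hfK x hx]
  · simp only [mem_compl_iff, hx, not_false_eq_true, indicator_of_mem]
    linarith [(abs_le.1 (h1 x)).1]

/-- Equality case of `|∫ f dμ| ≤ |μ|` for continuous `f` with `|f| ≤ 1`. -/
theorem eq_on_support_of_signedIntegral_eq [TopologicalSpace X] [HereditarilyLindelofSpace X]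
    [BorelSpace X] (μ : SignedMeasure X) {f : X → ℝ} (hf : Continuous f) (h1 : ∀ x, |f x| ≤ 1)
    (h : signedIntegral μ f = μ.toJordanDecomposition.posPart.real univ +
      μ.toJordanDecomposition.negPart.real univ) :
    (∀ x ∈ μ.toJordanDecomposition.posPart.support, f x = 1) ∧
      ∀ x ∈ μ.toJordanDecomposition.negPart.support, f x = -1 := by
  set P := μ.toJordanDecomposition.posPart with hP
  set N := μ.toJordanDecomposition.negPart with hN
  have hi : ∀ (m : Measure X) [IsFiniteMeasure m], Integrable f m := fun m _ =>
    .of_bound hf.measurable.aestronglyMeasurable 1 (.of_forall h1)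
  have e1 : ∫ x, (1 - f x) ∂P = P.real univ - ∫ x, f x ∂P := by
    rw [integral_sub (integrable_const 1) (hi P)]; simp
  have e2 : ∫ x, (1 + f x) ∂N = N.real univ + ∫ x, f x ∂N := by
    rw [integral_add (integrable_const 1) (hi N)]; simp
  have p1 : ∀ x, 0 ≤ 1 - f x := fun x => by linarith [(abs_le.1 (h1 x)).2]
  have p2 : ∀ x, 0 ≤ 1 + f x := fun x => by linarith [(abs_le.1 (h1 x)).1]
  have n1 : 0 ≤ ∫ x, (1 - f x) ∂P := integral_nonneg p1
  have n2 : 0 ≤ ∫ x, (1 + f x) ∂N := integral_nonneg p2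
  have h' : ∫ x, f x ∂P - ∫ x, f x ∂N = P.real univ + N.real univ := h
  -- The integrals of 1 - f against P and of 1 + f against N are nonnegative with sum zero, so both
  -- vanish.
  have z1 := (integral_eq_zero_iff_of_nonneg p1 ((integrable_const 1).sub (hi P))).1
    (by linarith)
  have z2 := (integral_eq_zero_iff_of_nonneg p2 ((integrable_const 1).add (hi N))).1
    (by linarith)
  constructor
  -- By continuity {f = 1} is closed, and a closed set of full measure contains the support.
  · refine Measure.support_subset_of_isClosed (t := {x | f x = 1})
      (isClosed_eq hf continuous_const) ?_
    filter_upwards [z1] with x hx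
    exact (sub_eq_zero.1 hx).symm
  · refine Measure.support_subset_of_isClosed (t := {x | f x = -1})
      (isClosed_eq hf continuous_const) ?_
    filter_upwards [z2] with x hx
    exact eq_neg_of_add_eq_zero_right hx

/-- In a hereditarily Lindelöf space the support has full measure, so values on it determine the
integral. -/
theorem signedIntegral_eq_of_eq_on_support [TopologicalSpace X] [HereditarilyLindelofSpace X]
    (μ : SignedMeasure X) {f : X → ℝ}
    (h1 : ∀ x ∈ μ.toJordanDecomposition.posPart.support, f x = 1)
    (h2 : ∀ x ∈ μ.toJordanDecomposition.negPart.support, f x = -1) :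
    signedIntegral μ f = μ.toJordanDecomposition.posPart.real univ +
      μ.toJordanDecomposition.negPart.real univ := by
  have e1 : ∫ x, f x ∂μ.toJordanDecomposition.posPart =
      ∫ _, 1 ∂μ.toJordanDecomposition.posPart :=
    integral_congr_ae (mem_of_superset Measure.support_mem_ae h1)
  have e2 : ∫ x, f x ∂μ.toJordanDecomposition.negPart =
      ∫ _, -1 ∂μ.toJordanDecomposition.negPart :=
    integral_congr_ae (mem_of_superset Measure.support_mem_ae h2)
  rw [signedIntegral, e1, e2]
  simp

end Duality

/-! ### Total variation as total mass, and integration by parts against Du. -/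

section TotalVariation

variable {T p : ℝ}

/-- Smooth Urysohn lemma in `(0, T)`. -/
theorem exists_testFunction_one_zero (hT : 0 < T) {K Z : Set ℝ} (hK : IsCompact K)
    (hKT : K ⊆ Ioo 0 T) (hZ : IsClosed Z) (hKZ : Disjoint K Z) :
    ∃ ψ : 𝓓(timeInterval T, ℝ), (∀ x ∈ K, ψ x = 1) ∧ (∀ x ∈ Z, ψ x = 0) ∧
      ∀ x, 0 ≤ ψ x ∧ ψ x ≤ 1 := by
  obtain ⟨a, b, ha, -, hb, hKab⟩ := IsCompact.exists_subset_Ioo hK hKT hT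
  obtain ⟨f, hf0, hf1, hf⟩ := exists_contMDiffMap_zero_one_of_isClosed (n := (⊤ : ℕ∞))
    (modelWithCornersSelf ℝ ℝ) (s := Z ∪ (Ioo a b)ᶜ) (t := K)
    (hZ.union isOpen_Ioo.isClosed_compl) hK.isClosed
    (Disjoint.union_left hKZ.symm (disjoint_compl_left_iff_subset.2 hKab))
  obtain ⟨ψ, hψ⟩ := exists_testFunction (T := T) (f := f) f.contMDiff.contDiff ha hb
    fun x hx => hf0 (.inr fun h => hx (Ioo_subset_Icc_self h))
  refine ⟨ψ, ?_⟩
  rw [hψ]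
  exact ⟨fun x hx => hf1 hx, fun x hx => hf0 (.inl hx), hf⟩

/-- The Jordan parts live on disjoint sets. Compact subsets of these nearly exhaust them, and a
difference of two Urysohn functions is 1 on one compact set and -1 on the other. -/
theorem exists_testFunction_le_signedIntegral (hT : 0 < T) (μ : SignedMeasure (Ioo 0 T))
    {ε : ℝ} (hε : 0 < ε) :
    ∃ ψ : 𝓓(timeInterval T, ℝ), (∀ t, |ψ t| ≤ 1) ∧
      μ.toJordanDecomposition.posPart.real univ + μ.toJordanDecomposition.negPart.real univ - ε ≤
        signedIntegral μ fun t => ψ (t : ℝ) := by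
  have : LocallyCompactSpace (Ioo 0 T) := isOpen_Ioo.locallyCompactSpace
  set P := μ.toJordanDecomposition.posPart with hP
  set N := μ.toJordanDecomposition.negPart with hN
  obtain ⟨S, hS, hPS, hNS⟩ := μ.toJordanDecomposition.mutuallySingular
  -- The mass ε/4 missed by each compact set costs 2 · ε/4 in `measureReal_sub_le_integral`, hence ε
  -- for the two parts together.
  have hcompact : ∀ (m : Measure (Ioo 0 T)) [IsFiniteMeasure m] (A : Set (Ioo 0 T)),
      MeasurableSet A → m Aᶜ = 0 → ∃ K ⊆ A, IsCompact K ∧ m.real Kᶜ ≤ ε / 4 := by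
    intro m _ A hA h0
    obtain ⟨K, hKA, hK, hlt⟩ := hA.exists_isCompact_sdiff_lt (μ := m) (measure_ne_top m A)
      (ε := ENNReal.ofReal (ε / 4)) (by simpa using by linarith)
    refine ⟨K, hKA, hK, ENNReal.toReal_le_of_le_ofReal (by linarith) ?_⟩
    calc m Kᶜ ≤ m (Aᶜ ∪ A \ K) := measure_mono fun x hx => by
          by_cases hxA : x ∈ A
          · exact .inr ⟨hxA, hx⟩
          · exact .inl hxA
      _ ≤ m Aᶜ + m (A \ K) := measure_union_le _ _
      _ ≤ _ := by rw [h0, zero_add]; exact hlt.le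
  obtain ⟨K₁, hK₁S, hK₁, hP₁⟩ := hcompact P Sᶜ hS.compl (by rwa [compl_compl])
  obtain ⟨K₂, hK₂S, hK₂, hN₂⟩ := hcompact N S hS hNS
  have hc₁ := hK₁.image continuous_subtype_val
  have hc₂ := hK₂.image continuous_subtype_val
  have hdisj : Disjoint (((↑) : Ioo 0 T → ℝ) '' K₁) ((↑) '' K₂) :=
    (disjoint_image_iff Subtype.val_injective).2
      (disjoint_of_subset hK₁S hK₂S disjoint_compl_left)
  have hsub : ∀ K : Set (Ioo 0 T), ((↑) : Ioo 0 T → ℝ) '' K ⊆ Ioo 0 T := by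
    rintro K _ ⟨x, -, rfl⟩
    exact x.2
  obtain ⟨ψ₁, h11, h10, h1⟩ :=
    exists_testFunction_one_zero hT hc₁ (hsub _) hc₂.isClosed hdisj
  obtain ⟨ψ₂, h21, h20, h2⟩ :=
    exists_testFunction_one_zero hT hc₂ (hsub _) hc₁.isClosed hdisj.symm
  have hψ : ∀ t, (ψ₁ - ψ₂) t = ψ₁ t - ψ₂ t := fun t => rfl
  have hle : ∀ t, |(ψ₁ - ψ₂) t| ≤ 1 := fun t => by
    rw [hψ, abs_le]
    constructor <;> linarith [(h1 t).1, (h1 t).2, (h2 t).1, (h2 t).2]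
  refine ⟨ψ₁ - ψ₂, hle, ?_⟩
  have hm : Measurable fun t : Ioo 0 T => (ψ₁ - ψ₂) (t : ℝ) :=
    (ψ₁ - ψ₂).continuous.measurable.comp measurable_subtype_coe
  have i1 := measureReal_sub_le_integral P hm (fun t => hle t) hK₁.measurableSet fun x hx => by
    rw [hψ, h11 _ (mem_image_of_mem _ hx), h20 _ (mem_image_of_mem _ hx), sub_zero]
  have i2 := measureReal_sub_le_integral N (f := fun t : Ioo 0 T => -(ψ₁ - ψ₂) (t : ℝ)) hm.neg
    (fun t => by rw [abs_neg]; exact hle t) hK₂.measurableSet fun x hx => by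
      rw [hψ, h10 _ (mem_image_of_mem _ hx), h21 _ (mem_image_of_mem _ hx)]; norm_num
  rw [integral_neg] at i2
  rw [signedIntegral]
  linarith

/-- The total variation of `u` is the total mass of its distributional derivative. -/
theorem totalVar_eq (hT : 0 < T) {u : LTime T p} {μ : SignedMeasure (Ioo 0 T)}
    (hμ : IsDistribDeriv u μ) :
    totalVar u = ((μ.toJordanDecomposition.posPart.real univ +
      μ.toJordanDecomposition.negPart.real univ : ℝ) : EReal) := by
  have hval : ∀ ψ : 𝓓(timeInterval T, ℝ), -∫ t, deriv ψ t * u t ∂timeMeasure T =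
      signedIntegral μ fun t => ψ (t : ℝ) := fun ψ => by rw [hμ ψ, neg_neg]
  apply le_antisymm
  · refine iSup₂_le fun ψ hψ => EReal.coe_le_coe_iff.2 ?_
    rw [hval]
    exact (le_abs_self _).trans (abs_signedIntegral_le μ fun t => hψ t)
  · refine EReal.ge_of_forall_gt_iff_ge.1 fun z hz => ?_
    rw [EReal.coe_lt_coe_iff] at hz
    obtain ⟨ψ, hψ, h⟩ := exists_testFunction_le_signedIntegral hT μ (sub_pos.2 hz)
    refine le_trans (EReal.coe_le_coe_iff.2 ?_) (le_totalVar u ψ hψ)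
    rw [hval]
    linarith

theorem monotone_measureReal_le (ν : Measure (Ioo 0 T)) [IsFiniteMeasure ν] :
    Monotone fun t => ν.real {s | (s : ℝ) ≤ t} := fun _ _ hxy =>
  measureReal_mono fun _ hs => le_trans hs hxy

theorem integrable_measureReal_le (ν : Measure (Ioo 0 T)) [IsFiniteMeasure ν] :
    Integrable (fun t => ν.real {s | (s : ℝ) ≤ t}) (timeMeasure T) :=
  .of_bound (monotone_measureReal_le ν).measurable.aestronglyMeasurable (ν.real univ)
    (.of_forall fun t => by
      rw [Real.norm_of_nonneg measureReal_nonneg]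
      exact measureReal_mono (subset_univ _))

/-- A function with derivative `μ` is, up to a constant, the distribution function of `μ`. -/
theorem IsDistribDeriv.ae_eq (hT : 0 < T) (hp : 1 ≤ p) {u : LTime T p}
    {μ : SignedMeasure (Ioo 0 T)} (hμ : IsDistribDeriv u μ) :
    ∃ c : ℝ, u =ᵐ[timeMeasure T] fun t =>
      c + (μ.toJordanDecomposition.posPart.real {s | (s : ℝ) ≤ t} -
        μ.toJordanDecomposition.negPart.real {s | (s : ℝ) ≤ t}) := by
  set P := μ.toJordanDecomposition.posPart with hP
  set N := μ.toJordanDecomposition.negPart with hN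
  have hiP := integrable_measureReal_le P
  have hiN := integrable_measureReal_le N
  have hu := lTime_integrable hp u
  obtain ⟨c, hc⟩ := ae_eq_const_of_integral_deriv_mul_eq_zero hT (hu.sub (hiP.sub hiN))
    (fun ψ => by
      have e : ∀ t, deriv ψ t * (u - ((fun t => P.real {s | (s : ℝ) ≤ t}) -
          fun t => N.real {s | (s : ℝ) ≤ t})) t =
          deriv ψ t * u t - (deriv ψ t * P.real {s | (s : ℝ) ≤ t} -
            deriv ψ t * N.real {s | (s : ℝ) ≤ t}) := fun t => by
        simp only [Pi.sub_apply]; ring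
      have hd := testFunction_deriv_integrable ψ
      have hd0 := integral_deriv_testFunction ψ
      have hi : Integrable (fun t => deriv ψ t * P.real {s | (s : ℝ) ≤ t} -
          deriv ψ t * N.real {s | (s : ℝ) ≤ t}) (timeMeasure T) :=
        (testFunction_deriv_mul_integrable ψ hiP).sub (testFunction_deriv_mul_integrable ψ hiN)
      simp_rw [e]
      rw [integral_sub (testFunction_deriv_mul_integrable ψ hu) hi,
        integral_sub (testFunction_deriv_mul_integrable ψ hiP)
          (testFunction_deriv_mul_integrable ψ hiN), integral_mul_measureReal_le hd hd0,
        integral_mul_measureReal_le hd hd0, hμ ψ, signedIntegral]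
      simp_rw [timePrimitive_deriv_testFunction]
      ring)
  refine ⟨c, ?_⟩
  filter_upwards [hc] with t ht
  simp only [Pi.sub_apply] at ht
  linarith

/-- Integration by parts against the derivative measure. -/
theorem IsDistribDeriv.integral_mul_eq (hT : 0 < T) (hp : 1 ≤ p) {u : LTime T p}
    {μ : SignedMeasure (Ioo 0 T)} (hμ : IsDistribDeriv u μ) {g : ℝ → ℝ}
    (hg : Integrable g (timeMeasure T)) (hg0 : ∫ t, g t ∂timeMeasure T = 0) :
    ∫ t, g t * u t ∂timeMeasure T = signedIntegral μ fun t => -timePrimitive T g t := by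
  obtain ⟨c, hc⟩ := hμ.ae_eq hT hp
  set P := μ.toJordanDecomposition.posPart with hP
  set N := μ.toJordanDecomposition.negPart with hN
  have hi : ∀ (ν : Measure (Ioo 0 T)) [IsFiniteMeasure ν],
      Integrable (fun t => g t * ν.real {s | (s : ℝ) ≤ t}) (timeMeasure T) := fun ν _ =>
    hg.mul_bdd (monotone_measureReal_le ν).measurable.aestronglyMeasurable (c := ν.real univ)
      (.of_forall fun t => by
        rw [Real.norm_of_nonneg measureReal_nonneg]
        exact measureReal_mono (subset_univ _))
  have h1 : ∫ t, g t * u t ∂timeMeasure T = ∫ t, (g t * c + (g t * P.real {s | (s : ℝ) ≤ t} -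
      g t * N.real {s | (s : ℝ) ≤ t})) ∂timeMeasure T := by
    refine integral_congr_ae ?_
    filter_upwards [hc] with t ht
    rw [ht]; ring
  have h2 : Integrable (fun t => g t * P.real {s | (s : ℝ) ≤ t} -
      g t * N.real {s | (s : ℝ) ≤ t}) (timeMeasure T) := (hi P).sub (hi N)
  rw [h1, integral_add (hg.mul_const c) h2, integral_sub (hi P) (hi N),
    integral_mul_const, hg0, integral_mul_measureReal_le hg hg0,
    integral_mul_measureReal_le hg hg0, signedIntegral, integral_neg, integral_neg]
  ring

end TotalVariation

/-! ### Subgradients, their primitives, and calibration. -/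

section Pairing

variable {T p q : ℝ}

theorem pairing_integrable (hpq : p.HolderConjugate q) (ξ : LTime T q) (v : LTime T p) :
    Integrable (fun t => ξ t * v t) (timeMeasure T) :=
  haveI : (ENNReal.ofReal q).HolderConjugate (ENNReal.ofReal p) := hpq.symm.ennrealOfReal
  (Lp.memLp ξ).integrable_mul (Lp.memLp v)

theorem timePairing_sub (hpq : p.HolderConjugate q) (ξ : LTime T q) (v w : LTime T p) :
    timePairing ξ (v - w) = timePairing ξ v - timePairing ξ w := by
  rw [timePairing, timePairing, timePairing,
    ← integral_sub (pairing_integrable hpq ξ v) (pairing_integrable hpq ξ w)]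
  refine integral_congr_ae ?_
  filter_upwards [Lp.coeFn_sub v w] with t ht
  rw [ht, Pi.sub_apply, mul_sub]

theorem timePairing_zero (ξ : LTime T q) : timePairing ξ (0 : LTime T p) = 0 := by
  refine integral_eq_zero_of_ae ?_
  filter_upwards [Lp.coeFn_zero ℝ (ENNReal.ofReal p) (timeMeasure T)] with t ht
  simp only [ht, Pi.zero_apply, mul_zero]

theorem totalVar_zero : totalVar (0 : LTime T p) = 0 := by
  refine le_antisymm (iSup₂_le fun ψ _ => ?_) (totalVar_nonneg _)
  have h : ∫ t, deriv ψ t * (0 : LTime T p) t ∂timeMeasure T = 0 := by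
    refine integral_eq_zero_of_ae ?_
    filter_upwards [Lp.coeFn_zero ℝ (ENNReal.ofReal p) (timeMeasure T)] with t ht
    simp only [ht, Pi.zero_apply, mul_zero]
  rw [h, neg_zero, EReal.coe_zero]

theorem totalVar_add_le (hp : 1 ≤ p) (u v : LTime T p) :
    totalVar (u + v) ≤ totalVar u + totalVar v := by
  refine iSup₂_le fun ψ hψ => ?_
  have h : ∫ t, deriv ψ t * (u + v : LTime T p) t ∂timeMeasure T =
      (∫ t, deriv ψ t * u t ∂timeMeasure T) + ∫ t, deriv ψ t * v t ∂timeMeasure T := by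
    rw [← integral_add (testFunction_deriv_mul_integrable ψ (lTime_integrable hp u))
      (testFunction_deriv_mul_integrable ψ (lTime_integrable hp v))]
    refine integral_congr_ae ?_
    filter_upwards [Lp.coeFn_add u v] with t ht
    rw [ht, Pi.add_apply, mul_add]
  rw [h, neg_add, EReal.coe_add]
  exact add_le_add (le_totalVar u ψ hψ) (le_totalVar v ψ hψ)

/-- Subgradients of the total variation are bounded by the total variation. -/
theorem timePairing_le_totalVar (hpq : p.HolderConjugate q) {u : LTime T p}
    (hu : u ∈ BVTime T p) {ξ : LTime T q} (hξ : ξ ∈ subdiff q totalVar u) (w : LTime T p) :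
    (timePairing ξ w : EReal) ≤ totalVar w := by
  have hbot : totalVar u ≠ ⊥ := ne_of_gt (EReal.bot_lt_zero.trans_le (totalVar_nonneg u))
  -- Subadditivity bounds R(u + w), and the finite number R(u) then cancels.
  have h := (hξ (u + w)).trans (totalVar_add_le hpq.lt.le u w)
  rw [add_sub_cancel_left] at h
  lift totalVar u to ℝ using ⟨ne_of_lt hu, hbot⟩ with M
  exact (EReal.addLECancellable_coe M).add_le_add_iff_left.1 h

/-- A subgradient of the total variation at `u` attains the total variation of `u`. -/
theorem totalVar_eq_timePairing (hpq : p.HolderConjugate q) {u : LTime T p}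
    (hu : u ∈ BVTime T p) {ξ : LTime T q} (hξ : ξ ∈ subdiff q totalVar u) :
    totalVar u = (timePairing ξ u : EReal) := by
  refine le_antisymm ?_ (timePairing_le_totalVar hpq hu hξ u)
  have hbot : totalVar u ≠ ⊥ := ne_of_gt (EReal.bot_lt_zero.trans_le (totalVar_nonneg u))
  have h := hξ 0
  rw [timePairing_sub hpq, timePairing_zero, totalVar_zero] at h
  lift totalVar u to ℝ using ⟨ne_of_lt hu, hbot⟩ with M
  rw [← EReal.coe_add, ← EReal.coe_zero, EReal.coe_le_coe_iff] at h
  rw [EReal.coe_le_coe_iff]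
  linarith

/-- The truncated constant `σ 1_{(0, t]}`. -/
noncomputable def timeStep (T p t σ : ℝ) : LTime T p :=
  indicatorConstLp (ENNReal.ofReal p) (measurableSet_Iic (a := t))
    (measure_ne_top (timeMeasure T) _) σ

theorem integral_mul_timeStep (g : ℝ → ℝ) (t σ : ℝ) :
    ∫ s, g s * timeStep T p t σ s ∂timeMeasure T = σ * timePrimitive T g t := by
  rw [timePrimitive, ← integral_indicator measurableSet_Iic, ← integral_const_mul]
  refine integral_congr_ae ?_
  filter_upwards [indicatorConstLp_coeFn (p := ENNReal.ofReal p) (hs := measurableSet_Iic (a := t))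
    (hμs := measure_ne_top (timeMeasure T) _) (c := σ)] with s hs
  rw [timeStep, hs]
  by_cases h : s ≤ t <;> simp [h, mul_comm]

/-- Pairing the step with -ψ' leaves only -σψ(t). The bound c is kept general: 1 serves for any t,
while 0 is possible at t = T, where test functions vanish. -/
theorem totalVar_timeStep_le {t σ c : ℝ}
    (h : ∀ ψ : 𝓓(timeInterval T, ℝ), (∀ t, |ψ t| ≤ 1) → -(σ * ψ t) ≤ c) :
    totalVar (timeStep T p t σ) ≤ c := by
  refine iSup₂_le fun ψ hψ => EReal.coe_le_coe_iff.2 ?_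
  rw [integral_mul_timeStep, timePrimitive_deriv_testFunction]
  exact h ψ hψ

theorem timePrimitive_subgradient_le (hpq : p.HolderConjugate q) {u : LTime T p}
    (hu : u ∈ BVTime T p) {ξ : LTime T q} (hξ : ξ ∈ subdiff q totalVar u) {t σ c : ℝ}
    (h : ∀ ψ : 𝓓(timeInterval T, ℝ), (∀ t, |ψ t| ≤ 1) → -(σ * ψ t) ≤ c) :
    σ * timePrimitive T ξ t ≤ c := by
  have h1 := (timePairing_le_totalVar hpq hu hξ (timeStep T p t σ)).trans (totalVar_timeStep_le h)
  rwa [timePairing, integral_mul_timeStep, EReal.coe_le_coe_iff] at h1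

theorem abs_timePrimitive_subgradient_le (hpq : p.HolderConjugate q) {u : LTime T p}
    (hu : u ∈ BVTime T p) {ξ : LTime T q} (hξ : ξ ∈ subdiff q totalVar u) (t : ℝ) :
    |timePrimitive T ξ t| ≤ 1 := by
  have h1 := timePrimitive_subgradient_le hpq hu hξ (t := t) (σ := 1) (c := 1) fun ψ hψ => by
    linarith [(abs_le.1 (hψ t)).1]
  have h2 := timePrimitive_subgradient_le hpq hu hξ (t := t) (σ := -1) (c := 1) fun ψ hψ => by
    linarith [(abs_le.1 (hψ t)).2]
  exact abs_le.2 ⟨by linarith, by linarith⟩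

/-- At t = T the step is constant on (0, T) and has no variation, so both signs of σ give the bound
0. -/
theorem integral_subgradient_eq_zero (hpq : p.HolderConjugate q) {u : LTime T p}
    (hu : u ∈ BVTime T p) {ξ : LTime T q} (hξ : ξ ∈ subdiff q totalVar u) :
    ∫ t, ξ t ∂timeMeasure T = 0 := by
  have hψ : ∀ ψ : 𝓓(timeInterval T, ℝ), ψ T = 0 := fun ψ =>
    image_eq_zero_of_notMem_tsupport fun h => lt_irrefl _ (testFunction_support_subset ψ h).2
  have h1 := timePrimitive_subgradient_le hpq hu hξ (t := T) (σ := 1) (c := 0) fun ψ _ => by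
    simp [hψ]
  have h2 := timePrimitive_subgradient_le hpq hu hξ (t := T) (σ := -1) (c := 0) fun ψ _ => by
    simp [hψ]
  rw [timePrimitive_end] at h1 h2
  linarith

/-- Weak differentiation of a primitive. -/
theorem integral_deriv_mul_timePrimitive {g : ℝ → ℝ} (hg : Integrable g (timeMeasure T))
    (ψ : 𝓓(timeInterval T, ℝ)) :
    ∫ t, deriv ψ t * timePrimitive T g t ∂timeMeasure T = -∫ t, ψ t * g t ∂timeMeasure T := by
  have h := integral_mul_distribution_eq (ν := timeMeasure T) (τ := id) measurable_id
    (testFunction_deriv_integrable ψ) (integral_deriv_testFunction ψ) hg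
  simp_rw [timePrimitive_deriv_testFunction, mul_comm (g _)] at h
  exact h

theorem isW1Time_timePrimitive (hq : 1 ≤ q) (g : LTime T q) :
    IsW1Time (timePrimitive T g) g := by
  have hg := lTime_integrable hq g
  have hc := continuous_timePrimitive hg
  refine ⟨hc.continuousOn, ?_, integral_deriv_mul_timePrimitive hg⟩
  refine .of_bound hc.aestronglyMeasurable (∫ t, ‖g t‖ ∂timeMeasure T) (.of_forall fun t => ?_)
  exact (norm_integral_le_integral_norm _).trans
    (setIntegral_le_integral hg.norm (.of_forall fun s => norm_nonneg _))

/-- The continuous representative of a Sobolev function is the primitive of its weak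
derivative. -/
theorem IsW1Time.eqOn_timePrimitive (hT : 0 < T) (hq : 1 ≤ q) {φ : ℝ → ℝ} {g : LTime T q}
    (h : IsW1Time φ g) (h0 : φ 0 = 0) : EqOn φ (timePrimitive T g) (Icc 0 T) := by
  have hg := lTime_integrable hq g
  have hc := continuous_timePrimitive hg
  have hφ : Integrable φ (timeMeasure T) := h.memLp.integrable (by simpa using hq)
  have hP : Integrable (timePrimitive T g) (timeMeasure T) :=
    (isW1Time_timePrimitive hq g).memLp.integrable (by simpa using hq)
  obtain ⟨c, hcc⟩ := ae_eq_const_of_integral_deriv_mul_eq_zero hT (hφ.sub hP) fun ψ => by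
    simp_rw [Pi.sub_apply, mul_sub]
    rw [integral_sub (testFunction_deriv_mul_integrable ψ hφ)
      (testFunction_deriv_mul_integrable ψ hP), h.weakDeriv,
      integral_deriv_mul_timePrimitive hg, sub_self]
  -- Passing to the closed interval lets the continuous identity be evaluated at 0, which forces c =
  -- 0.
  replace hcc : φ - timePrimitive T g =ᵐ[volume.restrict (Icc 0 T)] fun _ => c := by
    rwa [← Measure.restrict_congr_set Ioo_ae_eq_Icc]
  have heq := Measure.eqOn_Icc_of_ae_eq volume hT.ne hcc
    (h.continuousOn.sub hc.continuousOn) continuousOn_const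
  have hc0 := heq (left_mem_Icc.2 hT.le)
  simp only [Pi.sub_apply, h0, timePrimitive_zero, sub_zero] at hc0
  intro t ht
  have := heq ht
  simp only [Pi.sub_apply, ← hc0] at this
  linarith

theorem abs_le_one_of_eLpNorm_top_le {φ : ℝ → ℝ} (hφ : ContinuousOn φ (Icc 0 T))
    (h : eLpNorm φ ∞ (timeMeasure T) ≤ 1) : ∀ t ∈ Ioo 0 T, |φ t| ≤ 1 := by
  -- Taking the maximum with 1 recasts the almost everywhere inequality as an equality of continuous
  -- functions, which then holds everywhere.
  have hae : (fun t => max |φ t| 1) =ᵐ[timeMeasure T] fun _ => 1 := by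
    rw [eLpNorm_exponent_top] at h
    filter_upwards [ae_le_eLpNormEssSup (f := φ) (μ := timeMeasure T)] with t ht
    refine max_eq_right ?_
    have h1 := ht.trans h
    rw [← ofReal_norm, ← ENNReal.ofReal_one] at h1
    exact (ENNReal.ofReal_le_ofReal_iff zero_le_one).1 h1
  have hc := hφ.mono Ioo_subset_Icc_self
  have heq := Measure.eqOn_Ioo_of_ae_eq volume hae (hc.abs.sup continuousOn_const)
    continuousOn_const
  exact fun t ht => (le_max_left _ _).trans (heq ht).le

/-- Sufficiency: a calibrating primitive yields a subgradient. -/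
theorem mem_subdiff_of_calibration (hT : 0 < T) (hpq : p.HolderConjugate q) {u : LTime T p}
    {μ : SignedMeasure (Ioo 0 T)} (hμ : IsDistribDeriv u μ) {ξ : LTime T q}
    (h0 : ∫ t, ξ t ∂timeMeasure T = 0) (h1 : ∀ t ∈ Ioo 0 T, |timePrimitive T ξ t| ≤ 1)
    (hP : ∀ t ∈ μ.toJordanDecomposition.posPart.support, -timePrimitive T ξ t = 1)
    (hN : ∀ t ∈ μ.toJordanDecomposition.negPart.support, -timePrimitive T ξ t = -1) :
    ξ ∈ subdiff q totalVar u := by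
  have hp := hpq.lt.le
  have hi := lTime_integrable hpq.symm.lt.le ξ
  intro v
  by_cases hv : v ∈ BVTime T p
  · have hν := isDistribDeriv_distribDeriv hp hv
    have e1 : timePairing ξ u = _ := hμ.integral_mul_eq hT hp hi h0
    have e2 : timePairing ξ v = _ := hν.integral_mul_eq hT hp hi h0
    -- Now ⟨ξ,u⟩ is the mass of Du, that is R(u), whereas ⟨ξ,v⟩ is at most the mass of Dv.
    rw [signedIntegral_eq_of_eq_on_support μ hP hN] at e1
    have e3 := (le_abs_self _).trans (abs_signedIntegral_le (distribDeriv v)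
      (f := fun t : Ioo 0 T => -timePrimitive T ξ t) fun t => by rw [abs_neg]; exact h1 t t.2)
    rw [timePairing_sub hpq, totalVar_eq hT hμ, totalVar_eq hT hν, ← EReal.coe_add,
      EReal.coe_le_coe_iff]
    linarith
  · rw [show totalVar v = ⊤ from not_lt_top_iff.1 hv]
    exact le_top

/-- Necessity: the primitive of a subgradient calibrates the derivative of `u`. -/
theorem calibration_of_mem_subdiff (hT : 0 < T) (hpq : p.HolderConjugate q) {u : LTime T p}
    (hu : u ∈ BVTime T p) {μ : SignedMeasure (Ioo 0 T)} (hμ : IsDistribDeriv u μ)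
    {ξ : LTime T q} (hξ : ξ ∈ subdiff q totalVar u) :
    (∀ t ∈ μ.toJordanDecomposition.posPart.support, -timePrimitive T ξ t = 1) ∧
      ∀ t ∈ μ.toJordanDecomposition.negPart.support, -timePrimitive T ξ t = -1 := by
  have hi := lTime_integrable hpq.symm.lt.le ξ
  have e1 : timePairing ξ u = _ :=
    hμ.integral_mul_eq hT hpq.lt.le hi (integral_subgradient_eq_zero hpq hu hξ)
  have e2 := totalVar_eq_timePairing hpq hu hξ
  rw [totalVar_eq hT hμ, EReal.coe_eq_coe_iff, e1] at e2
  exact eq_on_support_of_signedIntegral_eq μ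
    ((continuous_timePrimitive hi).neg.comp continuous_subtype_val)
    (fun t => by
      simp only [abs_neg]
      exact abs_timePrimitive_subgradient_le hpq hu hξ t) e2.symm

theorem timePrimitive_neg (ξ : LTime T q) (t : ℝ) :
    timePrimitive T (-ξ : LTime T q) t = -timePrimitive T ξ t := by
  rw [timePrimitive, timePrimitive, ← integral_neg]
  exact integral_congr_ae (ae_restrict_of_ae (Lp.coeFn_neg ξ))

end Pairing

/-! ### The characterization of the subdifferential. -/

theorem mainTheorem8 (T p q : ℝ) (hT : 0 < T) (hpq : p.HolderConjugate q)
    (u : LTime T p) (hu : u ∈ BVTime T p) :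
    IsDistribDeriv u (distribDeriv u) ∧
    ∀ ξ : LTime T q,
      (ξ ∈ subdiff q totalVar u ↔
        ∃ (φ : ℝ → ℝ) (φ' : LTime T q), IsW1Time φ φ' ∧ ξ = -φ' ∧ φ 0 = 0 ∧ φ T = 0 ∧
          eLpNorm φ ∞ (timeMeasure T) ≤ 1 ∧
          (∀ t ∈ (distribDeriv u).toJordanDecomposition.posPart.support, φ (t : ℝ) = 1) ∧
          (∀ t ∈ (distribDeriv u).toJordanDecomposition.negPart.support, φ (t : ℝ) = -1)) ∧
      (ξ ∈ subdiff q totalVar u → totalVar u = (timePairing ξ u : EReal)) := by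
  have hq : 1 ≤ q := hpq.symm.lt.le
  have hμ := isDistribDeriv_distribDeriv hpq.lt.le hu
  refine ⟨hμ, fun ξ => ⟨⟨fun hξ => ?_, ?_⟩, totalVar_eq_timePairing hpq hu⟩⟩
  · obtain ⟨hP, hN⟩ := calibration_of_mem_subdiff hT hpq hu hμ hξ
    refine ⟨timePrimitive T (-ξ : LTime T q), -ξ, isW1Time_timePrimitive hq _, (neg_neg ξ).symm,
      timePrimitive_zero, ?_, ?_, fun t ht => ?_, fun t ht => ?_⟩
    · rw [timePrimitive_neg, timePrimitive_end, integral_subgradient_eq_zero hpq hu hξ, neg_zero]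
    · rw [eLpNorm_exponent_top]
      refine (eLpNormEssSup_le_of_ae_bound (C := 1) (.of_forall fun t => ?_)).trans (by simp)
      rw [timePrimitive_neg, norm_neg]
      exact abs_timePrimitive_subgradient_le hpq hu hξ t
    · rw [timePrimitive_neg, hP t ht]
    · rw [timePrimitive_neg, hN t ht]
  · rintro ⟨φ, φ', hφ, rfl, h0, hφT, hnorm, hP, hN⟩
    -- Since φ(0) = 0, φ is the primitive of its weak derivative, so its pointwise conditions become
    -- conditions on the primitive of ξ.
    have heq := hφ.eqOn_timePrimitive hT hq h0
    have hprim : ∀ t ∈ Icc 0 T, timePrimitive T (-φ' : LTime T q) t = -φ t := fun t ht => by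
      rw [timePrimitive_neg, heq ht]
    refine mem_subdiff_of_calibration hT hpq hμ ?_ (fun t ht => ?_) (fun t ht => ?_)
      fun t ht => ?_
    · rw [← timePrimitive_end, hprim T (right_mem_Icc.2 hT.le), hφT, neg_zero]
    · rw [hprim t (Ioo_subset_Icc_self ht), abs_neg]
      exact abs_le_one_of_eLpNorm_top_le hφ.continuousOn hnorm t ht
    · rw [hprim t (Ioo_subset_Icc_self t.2), neg_neg, hP t ht]
    · rw [hprim t (Ioo_subset_Icc_self t.2), neg_neg, hN t ht]
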